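/- Let $\lambda,\theta>0$, let $k\ge 1$ be an integer, and let $\Delta_0\in\mathbb R$. Update packets are generated by a rate-$\lambda$ Poisson process (i.i.d. exponential interarrival times with rate $\lambda$, the first one counted from time $0$) and sent through a single-server queue that is empty at time $0$. The service times of the packets are i.i.d., independent of the arrivals, with the Erlang distribution $E(k,\theta)$, i.e. with density $s^{k-1}e^{-s/\theta}/(\theta^k\,\Gamma(k))$ on $s>0$. The discipline is LCFS without preemption with a buffer of size $1$: a packet in service is never interrupted; a packet arriving at an empty queue is served at once; a packet arriving during a service is put into the buffer, replacing (and thereby discarding) any packet waiting there; at the end of a service the packet in the buffer, if any, starts its service. Number the packets that are delivered ("successful" packets) $1,2,\dots$ in order of reception. For the $i$-th of them let $T_i$ be its system time (reception time minus generation time), let $D_i$ be its reception time, and let $Y_i=D_{i+1}-D_i$. The age $\Delta(t)$ is $t$ minus the generation time of the newest packet received up to time $t$, and is $\Delta_0+t$ before the first reception. The peak age is $P_i=\lim_{t\uparrow D_i}\Delta(t)$. Then, for every $i\ge 3$, the limit $P_i$ exists almost surely, $P_i$, $T_{i-1}$ and $Y_{i-1}$ are integrable, and \[ \mathbb E(P_i)=\mathbb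 E(T_{i-1})+\mathbb E(Y_{i-1})=\frac1\lambda+2k\theta-\frac{k\theta}{(1+\lambda\theta)^{k+1}} . \] -/

import Mathlib

open MeasureTheory ProbabilityTheory Filter Topology

noncomputable section

namespace LCFS

/-! Sample path description of the single-server queue with a one-place buffer and no preemption,
started empty at time `0`.  A sample path is given by the interarrival times `x 0, x 1, …`
(`x 0` is the generation time of the first packet) and by the service times `s 0, s 1, …` of the
packets.  Packets and successful packets are both numbered from `0`. -/

/-- Generation (arrival) time of packet `n`. -/
def arrivalTime (x : ℕ → ℝ) (n : ℕ) : ℝ := ∑ j ∈ Finset.range (n + 1), x j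

/-- The packets generated after packet `m` and no later than time `d`. -/
def arrivedSince (x : ℕ → ℝ) (m : ℕ) (d : ℝ) : Set ℕ := {n | m < n ∧ arrivalTime x n ≤ d}

open Classical in
/-- The packet served after packet `m`, if packet `m` leaves the server at time `d`.  Every arrival
during a service replaces the content of the buffer, so at time `d` the buffer holds the newest
packet generated since packet `m`; if there is none, the queue becomes empty and the next
generated packet is served. -/
def nextPacket (x : ℕ → ℝ) (m : ℕ) (d : ℝ) : ℕ :=
  if (arrivedSince x m d).Nonempty then sSup (arrivedSince x m d) else m + 1

/-- Index and delivery time of the `i`-th successful packet.  A packet starts its service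
at its arrival or at the departure of the previously served packet, whichever is later, and is
never interrupted. -/
def served (x s : ℕ → ℝ) : ℕ → ℕ × ℝ
  | 0 => (0, arrivalTime x 0 + s 0)
  | i + 1 =>
    let n := nextPacket x (served x s i).1 (served x s i).2
    (n, max (served x s i).2 (arrivalTime x n) + s n)

/-- True index of the `i`-th successful packet. -/
def successIndex (x s : ℕ → ℝ) (i : ℕ) : ℕ := (served x s i).1

/-- Time at which the `i`-th successful packet is received. -/
def deliveryTime (x s : ℕ → ℝ) (i : ℕ) : ℝ := (served x s i).2

/-- System time of the `i`-th successful packet, from its generation to its reception. -/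
def systemTime (x s : ℕ → ℝ) (i : ℕ) : ℝ :=
  deliveryTime x s i - arrivalTime x (successIndex x s i)

/-- Time between the receptions of the `i`-th and of the next successful packet. -/
def interdepartureTime (x s : ℕ → ℝ) (i : ℕ) : ℝ :=
  deliveryTime x s (i + 1) - deliveryTime x s i

/-- Generation times of the packets received up to time `τ`. -/
def receivedStamps (x s : ℕ → ℝ) (τ : ℝ) : Set ℝ :=
  {g | ∃ i, deliveryTime x s i ≤ τ ∧ g = arrivalTime x (successIndex x s i)}

open Classical in
/-- Instantaneous age at time `τ`: the time elapsed since the generation of the newest received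
packet; before the first reception it grows linearly from the initial age `Δ₀`. -/
def age (Δ₀ : ℝ) (x s : ℕ → ℝ) (τ : ℝ) : ℝ :=
  if (receivedStamps x s τ).Nonempty then τ - sSup (receivedStamps x s τ) else Δ₀ + τ

/-- Peak age: the left limit of the age at the reception of the `i`-th successful packet. -/
def peakAge (Δ₀ : ℝ) (x s : ℕ → ℝ) (i : ℕ) : ℝ :=
  Function.leftLim (age Δ₀ x s) (deliveryTime x s i)

end LCFS

end

/-! Just before a reception the newest received packet is the previously delivered one, so on every
regular path the peak age is a system time plus an interdeparture time (`peakAge_succ`). These split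
into waiting plus service and idle plus service.

The probabilistic core is that each service start is a regeneration. Whether packet `m` is the
`i`-th success depends on the past `pastSigma` and on the next interarrival time exceeding the wait
of `m` (`exists_isStart`). By memorylessness, at a service start the service time `S` and the
residual interarrival time are fresh independent Gamma and exponential variables
(`setLIntegral_start`), and `lintegral_of_start` sums over `m`.

Hence each service has mean `k * θ`, the idle time has mean `E[exp (-lam * S)] / lam = 1 / lam / (1
+ lam * θ) ^ k`, and the next wait is the age at time `S` of the last Poisson arrival in `[0, S]`,
or zero if there is none. Given `S = s` its mean is `1 / lam - (s + 1 / lam) * exp (-lam * s)`. In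
the total, the idle mean cancels against a term of the waiting mean. -/

namespace LCFS

/-! ### Sample paths: delivery order and the peak age identity -/

/-- Sample paths with positive interarrival and service times and without accumulation of
arrivals. -/
structure RegularPath (x s : ℕ → ℝ) : Prop where
  interarrival_pos : ∀ n, 0 < x n
  service_pos : ∀ n, 0 < s n
  arrival_unbounded : ∀ d, ∃ n, d < arrivalTime x n

lemma arrivalTime_succ (x : ℕ → ℝ) (n : ℕ) :
    arrivalTime x (n + 1) = arrivalTime x n + x (n + 1) :=
  Finset.sum_range_succ _ _

lemma arrivalTime_add (x : ℕ → ℝ) (m j : ℕ) :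
    arrivalTime x (m + j) = arrivalTime x m + ∑ l ∈ Finset.range j, x (m + 1 + l) := by
  induction j with
  | zero => simp
  | succ j ih =>
    rw [← add_assoc, arrivalTime_succ, ih, Finset.sum_range_succ, add_assoc]
    congr 3
    ring

lemma successIndex_zero (x s : ℕ → ℝ) : successIndex x s 0 = 0 := rfl

lemma deliveryTime_zero (x s : ℕ → ℝ) : deliveryTime x s 0 = arrivalTime x 0 + s 0 := rfl

lemma successIndex_succ (x s : ℕ → ℝ) (i : ℕ) :
    successIndex x s (i + 1) = nextPacket x (successIndex x s i) (deliveryTime x s i) := rfl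

lemma deliveryTime_succ (x s : ℕ → ℝ) (i : ℕ) :
    deliveryTime x s (i + 1) =
      max (deliveryTime x s i) (arrivalTime x (successIndex x s (i + 1))) +
        s (successIndex x s (i + 1)) := rfl

lemma systemTime_succ (i : ℕ) :
    systemTime x s (i + 1) =
      max (deliveryTime x s i - arrivalTime x (successIndex x s (i + 1))) 0 +
        s (successIndex x s (i + 1)) := by
  rw [systemTime, deliveryTime_succ, ← sub_self (arrivalTime x (successIndex x s (i + 1))),
    max_sub_sub_right]
  ring

lemma interdepartureTime_eq (i : ℕ) :
    interdepartureTime x s i =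
      max (arrivalTime x (successIndex x s (i + 1)) - deliveryTime x s i) 0 +
        s (successIndex x s (i + 1)) := by
  rw [interdepartureTime, deliveryTime_succ, ← sub_self (deliveryTime x s i),
    max_sub_sub_right, max_comm]
  ring

namespace RegularPath

variable {x s : ℕ → ℝ} (h : RegularPath x s)
include h

lemma arrivalTime_strictMono : StrictMono (arrivalTime x) :=
  strictMono_nat_of_lt_succ fun n => by
    rw [arrivalTime_succ]
    linarith [h.interarrival_pos (n + 1)]

/-- Both cases of the definition reduce to finitely many comparisons of arrival times. The strict
bound on packet `n + 1` is what later becomes a condition on a single interarrival time. -/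
lemma nextPacket_eq_iff {m n : ℕ} {d : ℝ} :
    nextPacket x m d = n ↔
      m < n ∧ d < arrivalTime x (n + 1) ∧ (arrivalTime x n ≤ d ∨ n = m + 1) := by
  have hmono := h.arrivalTime_strictMono
  unfold nextPacket
  split_ifs with hne
  · have hbdd : BddAbove (arrivedSince x m d) := by
      obtain ⟨N, hN⟩ := h.arrival_unbounded d
      exact ⟨N, fun n hn => (hmono.lt_iff_lt.1 (hn.2.trans_lt hN)).le⟩
    constructor
    · rintro rfl
      have hmem := Nat.sSup_mem hne hbdd
      refine ⟨hmem.1, ?_, Or.inl hmem.2⟩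
      by_contra! hcon
      have := le_csSup hbdd (show sSup (arrivedSince x m d) + 1 ∈ arrivedSince x m d from
        ⟨hmem.1.trans (Nat.lt_succ_self _), hcon⟩)
      omega
    · rintro ⟨hmn, hd, hor⟩
      have hle : ∀ l ∈ arrivedSince x m d, l ≤ n := fun l hl =>
        Nat.lt_succ_iff.1 (hmono.lt_iff_lt.1 (hl.2.trans_lt hd))
      have hn : n ∈ arrivedSince x m d := by
        refine ⟨hmn, ?_⟩
        rcases hor with hor | rfl
        · exact hor
        · obtain ⟨l, hl⟩ := hne
          exact (hmono.monotone hl.1).trans hl.2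
      exact le_antisymm (csSup_le hne hle) (le_csSup hbdd hn)
  · rw [Set.not_nonempty_iff_eq_empty] at hne
    constructor
    · rintro rfl
      refine ⟨Nat.lt_succ_self _, ?_, Or.inr rfl⟩
      by_contra! hcon
      exact (hne.le ⟨by omega, hcon⟩ : (m + 1 + 1) ∈ (∅ : Set ℕ))
    · rintro ⟨hmn, -, hor | rfl⟩
      · exact absurd (hne.le ⟨hmn, hor⟩ : n ∈ (∅ : Set ℕ)) (Set.notMem_empty _)
      · rfl

lemma successIndex_succ_spec (i : ℕ) :
    successIndex x s i < successIndex x s (i + 1) ∧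
      deliveryTime x s i < arrivalTime x (successIndex x s (i + 1) + 1) ∧
      (arrivalTime x (successIndex x s (i + 1)) ≤ deliveryTime x s i ∨
        successIndex x s (i + 1) = successIndex x s i + 1) :=
  h.nextPacket_eq_iff.1 rfl

lemma successIndex_strictMono : StrictMono (successIndex x s) :=
  strictMono_nat_of_lt_succ fun i => (h.successIndex_succ_spec i).1

lemma deliveryTime_strictMono : StrictMono (deliveryTime x s) :=
  strictMono_nat_of_lt_succ fun i => by
    rw [deliveryTime_succ]
    linarith [h.service_pos (successIndex x s (i + 1)),
      le_max_left (deliveryTime x s i) (arrivalTime x (successIndex x s (i + 1)))]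

/-- Deliveries respect the order of generation, so the last received packet is also the newest. -/
lemma age_eq (Δ₀ : ℝ) {i : ℕ} {τ : ℝ} (h₁ : deliveryTime x s i ≤ τ)
    (h₂ : τ < deliveryTime x s (i + 1)) :
    age Δ₀ x s τ = τ - arrivalTime x (successIndex x s i) := by
  have hgreatest : IsGreatest (receivedStamps x s τ) (arrivalTime x (successIndex x s i)) := by
    refine ⟨⟨i, h₁, rfl⟩, ?_⟩
    rintro _ ⟨j, hj, rfl⟩
    have hji : j ≤ i :=
      Nat.lt_succ_iff.1 (h.deliveryTime_strictMono.lt_iff_lt.1 (hj.trans_lt h₂))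
    exact h.arrivalTime_strictMono.monotone (h.successIndex_strictMono.monotone hji)
  rw [age, if_pos hgreatest.nonempty, hgreatest.csSup_eq]

lemma tendsto_age (Δ₀ : ℝ) (i : ℕ) :
    Tendsto (age Δ₀ x s) (𝓝[<] deliveryTime x s (i + 1))
      (𝓝 (systemTime x s i + interdepartureTime x s i)) := by
  have hlim : Tendsto (fun τ => τ - arrivalTime x (successIndex x s i))
      (𝓝[<] deliveryTime x s (i + 1))
      (𝓝 (deliveryTime x s (i + 1) - arrivalTime x (successIndex x s i))) :=
    (tendsto_id.sub_const _).mono_left nhdsWithin_le_nhds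
  have heq : systemTime x s i + interdepartureTime x s i =
      deliveryTime x s (i + 1) - arrivalTime x (successIndex x s i) := by
    rw [systemTime, interdepartureTime]
    ring
  rw [heq]
  refine hlim.congr' ?_
  filter_upwards [Ioo_mem_nhdsLT (h.deliveryTime_strictMono (Nat.lt_succ_self i))] with τ hτ
  exact (h.age_eq Δ₀ hτ.1.le hτ.2).symm

lemma peakAge_succ (Δ₀ : ℝ) (i : ℕ) :
    peakAge Δ₀ x s (i + 1) = systemTime x s i + interdepartureTime x s i :=
  leftLim_eq_of_tendsto (h.tendsto_age Δ₀ i)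

end RegularPath

end LCFS

/-! ### From lower Lebesgue integrals to Bochner integrals -/

section NonnegIntegral

variable {α : Type*} [MeasurableSpace α] {μ : Measure α}

lemma integrable_and_integral_eq_of_lintegral_ofReal {f : α → ℝ} {c : ℝ}
    (hf_ofReal : AEMeasurable (fun a => ENNReal.ofReal (f a)) μ) (hf0 : 0 ≤ᵐ[μ] f) (hc : 0 ≤ c)
    (h : ∫⁻ a, ENNReal.ofReal (f a) ∂μ = ENNReal.ofReal c) :
    Integrable f μ ∧ ∫ a, f a ∂μ = c := by
  have hf : AEMeasurable f μ :=
    hf_ofReal.ennreal_toReal.congr (hf0.mono fun a ha => ENNReal.toReal_ofReal ha)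
  refine ⟨⟨hf.aestronglyMeasurable, ?_⟩, ?_⟩
  · rw [hasFiniteIntegral_iff_ofReal hf0, h]
    exact ENNReal.ofReal_lt_top
  · rw [integral_eq_lintegral_of_nonneg_ae hf0 hf.aestronglyMeasurable, h,
      ENNReal.toReal_ofReal hc]

end NonnegIntegral

/-! ### Gamma and exponential laws -/

namespace ProbabilityTheory

lemma ae_pos_gammaMeasure (a r : ℝ) : ∀ᵐ y ∂gammaMeasure a r, 0 < y := by
  have hmeas : Measurable (gammaPDF a r) := (measurable_gammaPDFReal a r).ennreal_ofReal
  rw [gammaMeasure, ae_withDensity_iff hmeas]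
  filter_upwards [Measure.ae_ne volume (0 : ℝ)] with y hy hne
  by_contra! hle
  exact hne (gammaPDF_of_neg (lt_of_le_of_ne hle hy))

lemma lintegral_gammaMeasure {a r : ℝ} {g : ℝ → ENNReal} (hg : Measurable g) :
    ∫⁻ y, g y ∂gammaMeasure a r =
      ∫⁻ y in Set.Ioi 0,
        ENNReal.ofReal (r ^ a / Real.Gamma a * y ^ (a - 1) * Real.exp (-(r * y))) * g y := by
  have hmeas : Measurable (gammaPDF a r) := (measurable_gammaPDFReal a r).ennreal_ofReal
  rw [gammaMeasure, lintegral_withDensity_eq_lintegral_mul _ hmeas hg,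
    ← lintegral_indicator measurableSet_Ioi]
  refine lintegral_congr_ae ?_
  filter_upwards [Measure.ae_ne volume (0 : ℝ)] with y hy
  rcases lt_or_gt_of_ne hy with hy | hy
  · simp [gammaPDF_of_neg hy, hy.le]
  · rw [Set.indicator_of_mem (Set.mem_Ioi.2 hy), Pi.mul_apply, gammaPDF_of_nonneg hy.le]

lemma lintegral_expMeasure {r : ℝ} {g : ℝ → ENNReal} (hg : Measurable g) :
    ∫⁻ y, g y ∂expMeasure r =
      ∫⁻ y in Set.Ioi 0, ENNReal.ofReal (r * Real.exp (-(r * y))) * g y := by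
  rw [expMeasure, lintegral_gammaMeasure hg]
  simp

/-- The Gamma density absorbs the factor and becomes an unnormalised Gamma density of shape `a + b`
and rate `r + c`. Only `b = 0` and `b = 1` are needed. -/
lemma lintegral_rpow_mul_exp_gammaMeasure {a r b c : ℝ} (ha : 0 < a) (hr : 0 < r) (hb : 0 ≤ b)
    (hc : 0 ≤ c) :
    ∫⁻ y, ENNReal.ofReal (y ^ b * Real.exp (-(c * y))) ∂gammaMeasure a r =
      ENNReal.ofReal
        (r ^ a / Real.Gamma a * ((1 / (r + c)) ^ (a + b) * Real.Gamma (a + b))) := by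
  rw [lintegral_gammaMeasure (by fun_prop)]
  have hab : 0 < a + b := by positivity
  have hrc : 0 < r + c := by positivity
  have hint := Real.integral_rpow_mul_exp_neg_mul_Ioi hab hrc
  have hΓ := Real.Gamma_pos_of_pos hab
  have hΓa := Real.Gamma_pos_of_pos ha
  have hi : IntegrableOn (fun y : ℝ => y ^ (a + b - 1) * Real.exp (-((r + c) * y)))
      (Set.Ioi 0) := by
    refine Integrable.of_integral_ne_zero ?_
    rw [hint]
    positivity
  rw [← hint, ← integral_const_mul, ofReal_integral_eq_lintegral_ofReal (hi.const_mul _)]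
  · refine setLIntegral_congr_fun measurableSet_Ioi fun y hy => ?_
    have hy : 0 < y := hy
    rw [← ENNReal.ofReal_mul (by positivity)]
    congr 1
    rw [show a + b - 1 = (a - 1) + b by ring, Real.rpow_add hy,
      show -((r + c) * y) = -(r * y) + -(c * y) by ring, Real.exp_add]
    ring
  · filter_upwards [ae_restrict_mem measurableSet_Ioi] with y hy
    have hy : 0 < y := hy
    simp only [Pi.zero_apply]
    positivity

lemma integral_exp_gammaMeasure {a r c : ℝ} (ha : 0 < a) (hr : 0 < r) (hc : 0 ≤ c) :
    Integrable (fun y => Real.exp (-(c * y))) (gammaMeasure a r) ∧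
      ∫ y, Real.exp (-(c * y)) ∂gammaMeasure a r = (r / (r + c)) ^ a := by
  have hΓa := Real.Gamma_pos_of_pos ha
  refine integrable_and_integral_eq_of_lintegral_ofReal (by fun_prop)
    (ae_of_all _ fun y => (Real.exp_pos _).le) (by positivity) ?_
  have := lintegral_rpow_mul_exp_gammaMeasure ha hr le_rfl hc
  simp only [Real.rpow_zero, one_mul, add_zero] at this
  rw [this, Real.div_rpow hr.le (by positivity), Real.div_rpow zero_le_one (by positivity),
    Real.one_rpow]
  congr 1
  field_simp

lemma integral_mul_exp_gammaMeasure {a r c : ℝ} (ha : 0 < a) (hr : 0 < r) (hc : 0 ≤ c) :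
    Integrable (fun y => y * Real.exp (-(c * y))) (gammaMeasure a r) ∧
      ∫ y, y * Real.exp (-(c * y)) ∂gammaMeasure a r = a / (r + c) * (r / (r + c)) ^ a := by
  have hΓa := Real.Gamma_pos_of_pos ha
  refine integrable_and_integral_eq_of_lintegral_ofReal (by fun_prop)
    ?_ (by positivity) ?_
  · filter_upwards [ae_pos_gammaMeasure a r] with y hy
    simp only [Pi.zero_apply]
    positivity
  have := lintegral_rpow_mul_exp_gammaMeasure ha hr zero_le_one hc
  simp only [Real.rpow_one] at this
  rw [this, Real.div_rpow hr.le (by positivity), Real.div_rpow zero_le_one (by positivity),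
    Real.one_rpow, Real.Gamma_add_one ha.ne', Real.rpow_add (by positivity), Real.rpow_one]
  congr 1
  field_simp

lemma lintegral_id_gammaMeasure {a r : ℝ} (ha : 0 < a) (hr : 0 < r) :
    ∫⁻ y, ENNReal.ofReal y ∂gammaMeasure a r = ENNReal.ofReal (a / r) := by
  have h := integral_mul_exp_gammaMeasure ha hr le_rfl
  simp only [zero_mul, neg_zero, Real.exp_zero, mul_one, add_zero, div_self hr.ne',
    Real.one_rpow] at h
  rw [← h.2, ofReal_integral_eq_lintegral_ofReal h.1]
  filter_upwards [ae_pos_gammaMeasure a r] with y hy using hy.le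

/-- Memorylessness of the exponential distribution. -/
lemma lintegral_expMeasure_shift {r w : ℝ} (hw : 0 ≤ w) {g : ℝ → ENNReal} (hg : Measurable g) :
    ∫⁻ y, (if w < y then g (y - w) else 0) ∂expMeasure r =
      ENNReal.ofReal (Real.exp (-(r * w))) * ∫⁻ y, g y ∂expMeasure r := by
  rw [lintegral_expMeasure hg, lintegral_expMeasure
    (Measurable.ite measurableSet_Ioi (by fun_prop) measurable_const),
    ← lintegral_const_mul _ (by fun_prop), ← lintegral_indicator measurableSet_Ioi,
    ← lintegral_add_right_eq_self _ w, ← lintegral_indicator measurableSet_Ioi]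
  refine lintegral_congr fun y => ?_
  by_cases hy : 0 < y
  · rw [Set.indicator_of_mem (Set.mem_Ioi.2 (by positivity)),
      Set.indicator_of_mem (Set.mem_Ioi.2 hy), if_pos (by linarith), add_sub_cancel_right,
      ← mul_assoc, ← ENNReal.ofReal_mul (by positivity),
      show -(r * (y + w)) = -(r * w) + -(r * y) by ring, Real.exp_add]
    congr 2
    ring
  · rw [Set.indicator_of_notMem (s := Set.Ioi (0 : ℝ)) hy]
    have : ¬ w < y + w := by linarith
    simp [Set.indicator, this]

/-- The level `v` is exceeded with probability `exp (-(r * v))`, and the excess is then again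
exponential with mean `1 / r`. -/
lemma lintegral_expMeasure_excess {r v : ℝ} (hr : 0 < r) (hv : 0 ≤ v) :
    ∫⁻ y, ENNReal.ofReal (y - v) ∂expMeasure r = ENNReal.ofReal (Real.exp (-(r * v)) / r) := by
  have hm := lintegral_id_gammaMeasure one_pos hr
  have h := lintegral_expMeasure_shift (r := r) hv (g := ENNReal.ofReal) (by fun_prop)
  rw [expMeasure, hm, ← ENNReal.ofReal_mul (Real.exp_pos _).le, mul_one_div] at h
  rw [← h]
  refine lintegral_congr fun y => ?_
  split_ifs with hy
  · rfl
  · exact ENNReal.ofReal_of_nonpos (by linarith)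

end ProbabilityTheory

/-! ### Age of the last Poisson arrival in an interval -/

namespace LCFS

/-- Mean of `r` minus the last arrival in `[0, r]` (or minus `0`), restricted to exactly `n` arrivals
of a rate-`lam` Poisson process in `[0, r]`. -/
noncomputable def lastArrivalAge (lam : ℝ) (n : ℕ) (r : ℝ) : ENNReal :=
  if 0 ≤ r then
    ENNReal.ofReal (lam ^ n * r ^ (n + 1) / (n + 1).factorial * Real.exp (-(lam * r)))
  else 0

@[fun_prop]
lemma measurable_lastArrivalAge (lam : ℝ) (n : ℕ) : Measurable (lastArrivalAge lam n) :=
  Measurable.ite measurableSet_Ici (by fun_prop) measurable_const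

/-- The remaining time `q.1` if it is nonnegative and smaller than the interarrival time `q.2`. -/
noncomputable def ageBeforeNext (q : ℝ × ℝ) : ENNReal :=
  if 0 ≤ q.1 ∧ q.1 < q.2 then ENNReal.ofReal q.1 else 0

@[fun_prop]
lemma measurable_ageBeforeNext : Measurable ageBeforeNext := by
  have h : MeasurableSet {q : ℝ × ℝ | 0 ≤ q.1 ∧ q.1 < q.2} :=
    (measurableSet_le measurable_const measurable_fst).inter
      (measurableSet_lt measurable_fst measurable_snd)
  exact Measurable.ite h (by fun_prop) measurable_const

lemma lintegral_ageBeforeNext {lam : ℝ} (hlam : 0 < lam) (r : ℝ) :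
    ∫⁻ y, ageBeforeNext (r, y) ∂expMeasure lam =
      lastArrivalAge lam 0 r := by
  have := isProbabilityMeasure_expMeasure hlam
  by_cases hr : 0 ≤ r
  · simp only [ageBeforeNext, hr, true_and, lastArrivalAge, if_true]
    rw [lintegral_expMeasure_shift hr (g := fun _ => ENNReal.ofReal r) measurable_const]
    simp only [lintegral_const, measure_univ, mul_one]
    rw [← ENNReal.ofReal_mul (Real.exp_pos _).le]
    simp [mul_comm]
  · simp [ageBeforeNext, hr, lastArrivalAge]

/-- Conditioning on the first arrival at `y` leaves `n` arrivals in a window of length `r - y`. The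
computation is a convolution of a power with the exponential density. -/
lemma lintegral_lastArrivalAge {lam : ℝ} (hlam : 0 < lam) (n : ℕ) (r : ℝ) :
    ∫⁻ y, lastArrivalAge lam n (r - y) ∂expMeasure lam = lastArrivalAge lam (n + 1) r := by
  rw [lintegral_expMeasure (by fun_prop)]
  by_cases hr : 0 ≤ r
  swap
  · rw [lastArrivalAge, if_neg hr]
    refine (setLIntegral_congr_fun measurableSet_Ioi fun y (hy : 0 < y) => ?_).trans lintegral_zero
    have : ¬ 0 ≤ r - y := by linarith
    simp [lastArrivalAge, this]
  set C : ℝ := lam ^ (n + 1) * Real.exp (-(lam * r)) / (n + 1).factorial with hC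
  have hC0 : 0 ≤ C := by positivity
  have hpt : ∀ y, (Set.Ioi (0 : ℝ)).indicator (fun y =>
      ENNReal.ofReal (lam * Real.exp (-(lam * y))) * lastArrivalAge lam n (r - y)) y =
      (Set.Ioc 0 r).indicator (fun y => ENNReal.ofReal (C * (r - y) ^ (n + 1))) y := by
    intro y
    by_cases hy : 0 < y
    · by_cases hyr : y ≤ r
      · rw [Set.indicator_of_mem (Set.mem_Ioi.2 hy), Set.indicator_of_mem (Set.mem_Ioc.2 ⟨hy, hyr⟩),
          lastArrivalAge, if_pos (by linarith), ← ENNReal.ofReal_mul (by positivity)]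
        congr 1
        rw [hC, show -(lam * r) = -(lam * y) + -(lam * (r - y)) by ring, Real.exp_add]
        ring
      · have : ¬ 0 ≤ r - y := by linarith
        simp [Set.indicator, lastArrivalAge, this, hyr]
    · simp [Set.indicator, hy]
  rw [← lintegral_indicator measurableSet_Ioi, lintegral_congr hpt,
    lintegral_indicator measurableSet_Ioc,
    ← ofReal_integral_eq_lintegral_ofReal, ← intervalIntegral.integral_of_le hr,
    intervalIntegral.integral_const_mul,
    intervalIntegral.integral_comp_sub_left (fun y => y ^ (n + 1)) r, integral_pow,
    lastArrivalAge, if_pos hr]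
  · congr 1
    rw [hC, Nat.factorial_succ (n + 1)]
    push_cast
    field_simp
    simp
  · exact (Continuous.integrableOn_Icc (by fun_prop)).mono_set Set.Ioc_subset_Icc_self
  · filter_upwards [ae_restrict_mem measurableSet_Ioc] with y hy
    have : 0 ≤ r - y := by linarith [hy.2]
    simp only [Pi.zero_apply]
    positivity

/-- Up to the factor `exp (-(lam * r)) / lam`, this is the exponential series without its first two
terms: at least one arrival is required, and the power of `r` exceeds the number of arrivals by one.
-/
lemma hasSum_lastArrivalAge {lam : ℝ} (hlam : 0 < lam) (r : ℝ) :
    HasSum (fun n : ℕ => lam ^ (n + 1) * r ^ (n + 1 + 1) / (n + 1 + 1).factorial *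
        Real.exp (-(lam * r)))
      (1 / lam - (r + 1 / lam) * Real.exp (-(lam * r))) := by
  have h := NormedSpace.expSeries_div_hasSum_exp (lam * r)
  rw [← Real.exp_eq_exp_ℝ, ← hasSum_nat_add_iff' 2] at h
  have h' := h.mul_right (Real.exp (-(lam * r)) / lam)
  have hval : (Real.exp (lam * r) - ∑ n ∈ Finset.range 2, (lam * r) ^ n / (n.factorial : ℝ)) *
      (Real.exp (-(lam * r)) / lam) = 1 / lam - (r + 1 / lam) * Real.exp (-(lam * r)) := by
    have hexp : Real.exp (lam * r) * Real.exp (-(lam * r)) = 1 := by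
      rw [← Real.exp_add]
      simp
    simp only [Finset.sum_range_succ, Finset.sum_range_zero, pow_zero, pow_one,
      Nat.factorial_zero, Nat.factorial_one, Nat.cast_one, div_one]
    field_simp
    linear_combination hexp
  rw [hval] at h'
  refine (congrArg (HasSum · _) (funext fun n => ?_)).mp h'
  rw [mul_pow]
  field_simp
  ring

lemma tsum_lastArrivalAge {lam r : ℝ} (hlam : 0 < lam) (hr : 0 ≤ r) :
    ∑' n : ℕ, lastArrivalAge lam (n + 1) r =
      ENNReal.ofReal (1 / lam - (r + 1 / lam) * Real.exp (-(lam * r))) := by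
  have h := hasSum_lastArrivalAge hlam r
  rw [← h.tsum_eq, ENNReal.ofReal_tsum_of_nonneg (fun n => by positivity) h.summable]
  simp only [lastArrivalAge, if_pos hr]

lemma lintegral_tsum_lastArrivalAge {lam θ : ℝ} (hlam : 0 < lam) (hθ : 0 < θ) {k : ℕ}
    (hk : 1 ≤ k) :
    ∃ c : ℝ, 0 ≤ c ∧ c = 1 / lam - 1 / lam / (1 + lam * θ) ^ k - k * θ / (1 + lam * θ) ^ (k + 1) ∧
    ∫⁻ y, ENNReal.ofReal (1 / lam - (y + 1 / lam) * Real.exp (-(lam * y)))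
      ∂gammaMeasure (k : ℝ) θ⁻¹ = ENNReal.ofReal c := by
  have hk0 : (0 : ℝ) < k := by exact_mod_cast hk
  have hr : 0 < θ⁻¹ := by positivity
  have := isProbabilityMeasure_gammaMeasure hk0 hr
  obtain ⟨hi0, he0⟩ := integral_exp_gammaMeasure hk0 hr hlam.le
  obtain ⟨hi1, he1⟩ := integral_mul_exp_gammaMeasure hk0 hr hlam.le
  have hnn : ∀ᵐ y ∂gammaMeasure (k : ℝ) θ⁻¹,
      0 ≤ 1 / lam - (y + 1 / lam) * Real.exp (-(lam * y)) := by
    filter_upwards [ae_pos_gammaMeasure (k : ℝ) θ⁻¹] with y hy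
    -- The closed form is nonnegative because it is the sum of a series of nonnegative terms.
    exact (hasSum_lastArrivalAge hlam y).nonneg fun n => by positivity
  have hi : Integrable (fun y => 1 / lam - (y * Real.exp (-(lam * y)) +
      1 / lam * Real.exp (-(lam * y)))) (gammaMeasure (k : ℝ) θ⁻¹) :=
    (integrable_const _).sub (hi1.add (hi0.const_mul _))
  have heq : (fun y => 1 / lam - (y + 1 / lam) * Real.exp (-(lam * y))) =
      fun y => 1 / lam - (y * Real.exp (-(lam * y)) + 1 / lam * Real.exp (-(lam * y))) := by
    ext y
    ring
  refine ⟨_, integral_nonneg_of_ae hnn, ?_, ?_⟩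
  · have hadd := integral_add hi1 (hi0.const_mul (1 / lam))
    have hsub := integral_sub (integrable_const (1 / lam)) (hi1.add (hi0.const_mul (1 / lam)))
    simp only [Pi.add_apply] at hsub
    rw [heq, hsub, hadd, integral_const_mul, he0, he1]
    simp only [integral_const, probReal_univ, smul_eq_mul, one_mul, Real.rpow_natCast]
    have : θ⁻¹ / (θ⁻¹ + lam) = 1 / (1 + lam * θ) := by field_simp
    have h2 : (k : ℝ) / (θ⁻¹ + lam) = k * θ / (1 + lam * θ) := by field_simp
    rw [this, h2, div_pow, one_pow, pow_succ]
    field_simp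
    ring
  · rw [ofReal_integral_eq_lintegral_ofReal (heq ▸ hi) hnn]

end LCFS

/-! ### Integrating out one member of an independent family -/

namespace ProbabilityTheory

section FamilySigma

variable {ι Ω : Type*} {Z : ι → Ω → ℝ} {T : Set ι}

/-- The σ-algebra generated by the members of a family of random variables with index in `T`. -/
@[reducible] def familySigma (Z : ι → Ω → ℝ) (T : Set ι) : MeasurableSpace Ω :=
  ⨆ t ∈ T, MeasurableSpace.comap (Z t) inferInstance

lemma familySigma_mono (Z : ι → Ω → ℝ) {T T' : Set ι} (h : T ⊆ T') :
    familySigma Z T ≤ familySigma Z T' :=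
  biSup_mono h

lemma measurable_familySigma {t : ι} (ht : t ∈ T) : Measurable[familySigma Z T] (Z t) :=
  Measurable.mono (comap_measurable (Z t))
    (le_biSup (fun t => MeasurableSpace.comap (Z t) inferInstance) ht) le_rfl

lemma familySigma_le [mΩ : MeasurableSpace Ω] (hZ : ∀ t, Measurable (Z t)) :
    familySigma Z T ≤ mΩ :=
  iSup₂_le fun t _ => (hZ t).comap_le

variable [mΩ : MeasurableSpace Ω] {μ : Measure Ω} [IsProbabilityMeasure μ]

/-- Integrating out a member of an independent family, given some of the other members. -/
lemma lintegral_integrate_out (hZ : ∀ t, Measurable (Z t)) (hind : iIndepFun Z μ) {t : ι}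
    (ht : t ∉ T) {β : Type*} [MeasurableSpace β] {Y : Ω → β} (hY : Measurable[familySigma Z T] Y)
    {f : β × ℝ → ENNReal} (hf : Measurable f) :
    ∫⁻ ω, f (Y ω, Z t ω) ∂μ = ∫⁻ ω, ∫⁻ z, f (Y ω, z) ∂(μ.map (Z t)) ∂μ := by
  have hle : familySigma Z T ≤ mΩ := familySigma_le hZ
  have hY' : Measurable Y := hY.mono hle le_rfl
  have hindep : IndepFun Y (Z t) μ := by
    have h := indep_iSup_of_disjoint (fun t => (hZ t).comap_le) hind.iIndep
      (Set.disjoint_singleton_right.2 ht)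
    rw [IndepFun_iff_Indep]
    refine indep_of_indep_of_le_left (indep_of_indep_of_le_right h ?_) hY.comap_le
    simp
  have hmap := (indepFun_iff_map_prod_eq_prod_map_map hY'.aemeasurable (hZ t).aemeasurable).1 hindep
  have := Measure.isProbabilityMeasure_map (μ := μ) (hZ t).aemeasurable
  rw [← lintegral_map (f := f) hf (hY'.prodMk (hZ t)), hmap, lintegral_prod _ hf.aemeasurable,
    lintegral_map hf.lintegral_prod_right' hY']

lemma setLIntegral_integrate_out (hZ : ∀ t, Measurable (Z t)) (hind : iIndepFun Z μ) {t : ι}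
    (ht : t ∉ T) {β : Type*} [MeasurableSpace β] {Y : Ω → β} (hY : Measurable[familySigma Z T] Y)
    {B : Set Ω} (hB : MeasurableSet[familySigma Z T] B)
    {f : β × ℝ → ENNReal} (hf : Measurable f) :
    ∫⁻ ω in B, f (Y ω, Z t ω) ∂μ = ∫⁻ ω in B, ∫⁻ z, f (Y ω, z) ∂(μ.map (Z t)) ∂μ := by
  have hle : familySigma Z T ≤ mΩ := familySigma_le hZ
  have hc : Measurable[familySigma Z T] (B.indicator (fun _ => (1 : ENNReal))) :=
    measurable_const.indicator hB
  -- The restriction to `B` is carried as an extra coordinate, the indicator of `B`, multiplying the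
  -- integrand.
  have h := lintegral_integrate_out hZ hind ht (hc.prodMk hY)
    (f := fun p => p.1.1 * f (p.1.2, p.2)) (by fun_prop)
  simp only at h
  rw [← lintegral_indicator (hle _ hB), ← lintegral_indicator (hle _ hB)]
  convert h using 1
  · refine lintegral_congr fun ω => ?_
    by_cases hω : ω ∈ B <;> simp [hω]
  · refine lintegral_congr fun ω => ?_
    by_cases hω : ω ∈ B <;> simp [hω]

end FamilySigma

end ProbabilityTheory

/-! ### Service starts as events of the past and one interarrival time -/

namespace LCFS

variable {Ω : Type*} {X S : ℕ → Ω → ℝ}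

/-- Indices of the interarrival times up to the arrival of packet `m` and of the service times of
the packets before `m`. -/
def pastIndices (m : ℕ) : Set (ℕ ⊕ ℕ) := {t | Sum.elim (fun n => n ≤ m) (fun n => n < m) t}

/-- The information available at the arrival of packet `m`, with the service times of the packets
before `m`. -/
abbrev pastSigma (X S : ℕ → Ω → ℝ) (m : ℕ) : MeasurableSpace Ω :=
  familySigma (Sum.elim X S) (pastIndices m)

lemma pastSigma_mono (X S : ℕ → Ω → ℝ) {m n : ℕ} (h : m ≤ n) :
    pastSigma X S m ≤ pastSigma X S n := by
  refine familySigma_mono _ ?_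
  rintro (t | t) ht
  · exact le_trans (α := ℕ) ht h
  · exact lt_of_lt_of_le (α := ℕ) ht h

lemma measurable_interarrival_pastSigma {m n : ℕ} (h : n ≤ m) :
    Measurable[pastSigma X S m] (X n) :=
  measurable_familySigma (Z := Sum.elim X S) (t := Sum.inl n) h

lemma measurable_service_pastSigma {m n : ℕ} (h : n < m) :
    Measurable[pastSigma X S m] (S n) :=
  measurable_familySigma (Z := Sum.elim X S) (t := Sum.inr n) h

lemma measurable_arrivalTime_pastSigma {m n : ℕ} (h : n ≤ m) :
    Measurable[pastSigma X S m] (fun ω => arrivalTime (X · ω) n) :=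
  Finset.measurable_fun_sum _ fun _ hj =>
    measurable_interarrival_pastSigma ((Finset.mem_range_succ_iff.1 hj).trans h)

/-- On regular paths packet `m` is the `i`-th successful one if and only if the event `A` happens
and the next arrival occurs later than the waiting time `w` of packet `m`; both are determined
by the information available at the arrival of `m`. -/
structure IsStart (X S : ℕ → Ω → ℝ) (i m : ℕ) (A : Set Ω) (w : Ω → ℝ) : Prop where
  measurableSet_event : MeasurableSet[pastSigma X S m] A
  measurable_wait : Measurable[pastSigma X S m] w
  wait_nonneg : ∀ ω, 0 ≤ w ω
  successIndex_eq_iff : ∀ ω, RegularPath (X · ω) (S · ω) →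
    (successIndex (X · ω) (S · ω) i = m ↔ ω ∈ A ∧ w ω < X (m + 1) ω)
  deliveryTime_eq : ∀ ω, RegularPath (X · ω) (S · ω) → successIndex (X · ω) (S · ω) i = m →
    deliveryTime (X · ω) (S · ω) i = arrivalTime (X · ω) m + w ω + S m ω

/-- The event that packet `m` starts a service. -/
def startEvent (X : ℕ → Ω → ℝ) (m : ℕ) (A : Set Ω) (w : Ω → ℝ) : Set Ω :=
  A ∩ {ω | w ω < X (m + 1) ω}

lemma IsStart.measurableSet_startEvent {i m : ℕ} {A : Set Ω} {w : Ω → ℝ}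
    (h : IsStart X S i m A w) :
    MeasurableSet[pastSigma X S (m + 1)] (startEvent X m A w) := by
  have hle := pastSigma_mono X S (Nat.le_succ m)
  refine MeasurableSet.inter (hle _ h.measurableSet_event) ?_
  exact @measurableSet_lt _ _ _ _ _ (pastSigma X S (m + 1)) _ _ _ _ _
    (h.measurable_wait.mono hle le_rfl) (measurable_interarrival_pastSigma le_rfl)

/-- Induction over the served packets. Packet `m` follows packet `l` if it arrives before `l`
departs or is the immediate successor of `l`, and no further packet arrives by that departure. The
last condition says exactly that the next interarrival time exceeds the wait of `m`. -/
lemma exists_isStart (X S : ℕ → Ω → ℝ) (i : ℕ) :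
    ∃ (A : ℕ → Set Ω) (w : ℕ → Ω → ℝ), ∀ m, IsStart X S i m (A m) (w m) := by
  classical
  induction i with
  | zero =>
    refine ⟨fun m => if m = 0 then Set.univ else ∅, fun _ _ => 0, fun m => ⟨?_, measurable_const,
      fun _ => le_rfl, ?_, ?_⟩⟩
    · beta_reduce
      split_ifs
      · exact MeasurableSet.univ
      · exact @MeasurableSet.empty _ (pastSigma X S m)
    · intro ω hω
      rw [successIndex_zero]
      by_cases hm : m = 0
      · simp [hm, hω.interarrival_pos 1]
      · simp [hm, Ne.symm hm]
    · rintro ω hω rfl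
      simp [successIndex_zero, deliveryTime_zero]
  | succ i ih =>
    obtain ⟨A, w, h⟩ := ih
    let d : ℕ → Ω → ℝ := fun l ω => arrivalTime (X · ω) l + w l ω + S l ω
    let E : ℕ → ℕ → Set Ω := fun m l => startEvent X l (A l) (w l) ∩
      ({ω | arrivalTime (X · ω) m ≤ d l ω} ∪ {_ω | m = l + 1})
    have hd : ∀ m l, l < m → Measurable[pastSigma X S m] (d l) := fun m l hl =>
      ((measurable_arrivalTime_pastSigma hl.le).add ((h l).measurable_wait.mono
        (pastSigma_mono X S hl.le) le_rfl)).add (measurable_service_pastSigma hl)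
    have hE : ∀ m l, l < m → MeasurableSet[pastSigma X S m] (E m l) := fun m l hl => by
      refine MeasurableSet.inter (pastSigma_mono X S hl _ (h l).measurableSet_startEvent)
        (MeasurableSet.union ?_ (MeasurableSet.const _))
      exact @measurableSet_le _ _ _ _ _ (pastSigma X S m) _ _ _ _ _
        (measurable_arrivalTime_pastSigma le_rfl) (hd m l hl)
    have hE_iff : ∀ ω, RegularPath (X · ω) (S · ω) → ∀ m l, ω ∈ E m l ↔
        successIndex (X · ω) (S · ω) i = l ∧
          (arrivalTime (X · ω) m ≤ deliveryTime (X · ω) (S · ω) i ∨ m = l + 1) := by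
      intro ω hω m l
      have hiff := (h l).successIndex_eq_iff ω hω
      constructor
      · rintro ⟨h₁, h₂⟩
        have hl := hiff.2 h₁
        refine ⟨hl, ?_⟩
        rw [(h l).deliveryTime_eq ω hω hl]
        exact h₂
      · rintro ⟨hl, h₂⟩
        refine ⟨hiff.1 hl, ?_⟩
        rw [(h l).deliveryTime_eq ω hω hl] at h₂
        exact h₂
    -- On a regular path at most one `E m l` occurs, since `l` must be the `i`-th successful packet.
    -- The finite sum selects its term while keeping measurability visible.
    let w' : ℕ → Ω → ℝ := fun m ω => ∑ l ∈ Finset.range m,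
      (E m l).indicator (fun ω => max (d l ω - arrivalTime (X · ω) m) 0) ω
    have hw' : ∀ ω, RegularPath (X · ω) (S · ω) → ∀ m l, l < m → ω ∈ E m l →
        w' m ω = max (deliveryTime (X · ω) (S · ω) i - arrivalTime (X · ω) m) 0 := by
      intro ω hω m l hl hmem
      have hs := ((hE_iff ω hω m l).1 hmem).1
      simp only [w']
      rw [Finset.sum_eq_single_of_mem l (Finset.mem_range.2 hl), Set.indicator_of_mem hmem,
        (h l).deliveryTime_eq ω hω hs]
      intro l' _ hne
      refine Set.indicator_of_notMem (fun hmem' => hne ?_) _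
      rw [← ((hE_iff ω hω m l').1 hmem').1, hs]
    have hiff : ∀ ω, RegularPath (X · ω) (S · ω) → ∀ m,
        (successIndex (X · ω) (S · ω) (i + 1) = m ↔
          ω ∈ ⋃ l ∈ Finset.range m, E m l ∧ w' m ω < X (m + 1) ω) := by
      intro ω hω m
      rw [successIndex_succ, hω.nextPacket_eq_iff, arrivalTime_succ]
      have hpos := hω.interarrival_pos (m + 1)
      simp only [Set.mem_iUnion, Finset.mem_range, exists_prop]
      constructor
      · rintro ⟨h₁, h₂, h₃⟩
        have hmem := (hE_iff ω hω m _).2 ⟨rfl, h₃⟩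
        refine ⟨⟨_, h₁, hmem⟩, ?_⟩
        rw [hw' ω hω m _ h₁ hmem]
        exact max_lt (by linarith) hpos
      · rintro ⟨⟨l, hl, hmem⟩, hlt⟩
        rw [hw' ω hω m l hl hmem, max_lt_iff] at hlt
        obtain ⟨rfl, h₃⟩ := (hE_iff ω hω m l).1 hmem
        exact ⟨hl, by linarith [hlt.1], h₃⟩
    refine ⟨fun m => ⋃ l ∈ Finset.range m, E m l, w', fun m => ⟨?_, ?_, ?_, ?_, ?_⟩⟩
    · exact Finset.measurableSet_biUnion _ fun l hl => hE m l (Finset.mem_range.1 hl)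
    · refine Finset.measurable_fun_sum _ fun l hl => ?_
      have hl := Finset.mem_range.1 hl
      exact Measurable.indicator (((hd m l hl).sub
        (measurable_arrivalTime_pastSigma le_rfl)).max measurable_const) (hE m l hl)
    · exact fun ω => Finset.sum_nonneg fun l _ =>
        Set.indicator_nonneg (fun _ _ => le_max_right _ _) _
    · exact fun ω hω => hiff ω hω m
    · intro ω hω hm
      have hmem := ((hiff ω hω m).1 hm).1
      simp only [Set.mem_iUnion, Finset.mem_range, exists_prop] at hmem
      obtain ⟨l, hl, hmem⟩ := hmem
      rw [deliveryTime_succ, hm, hw' ω hω m l hl hmem,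
        ← sub_self (arrivalTime (X · ω) m), max_sub_sub_right]
      ring

/-! ### Regeneration at service starts -/

variable [mΩ : MeasurableSpace Ω] {μ : Measure Ω} {lam θ : ℝ} {k : ℕ}

/-- Independent measurable inputs of the queue: exponential interarrival times and Erlang
service times. -/
structure IsQueueInput (μ : Measure Ω) (lam θ : ℝ) (k : ℕ) (X S : ℕ → Ω → ℝ) : Prop where
  lam_pos : 0 < lam
  theta_pos : 0 < θ
  k_pos : 1 ≤ k
  measurable_input : ∀ t, Measurable (Sum.elim X S t)
  map_interarrival : ∀ n, μ.map (X n) = expMeasure lam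
  map_service : ∀ n, μ.map (S n) = gammaMeasure (k : ℝ) θ⁻¹
  indep : iIndepFun (Sum.elim X S) μ

namespace IsQueueInput

variable (h : IsQueueInput μ lam θ k X S)
include h

lemma measurable_interarrival (n : ℕ) : Measurable (X n) := h.measurable_input (Sum.inl n)

lemma measurable_service (n : ℕ) : Measurable (S n) := h.measurable_input (Sum.inr n)

lemma pastSigma_le (m : ℕ) : pastSigma X S m ≤ mΩ := familySigma_le h.measurable_input

lemma integral_interarrival (n : ℕ) :
    Integrable (X n) μ ∧ ∫ ω, X n ω ∂μ = 1 / lam := by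
  have hmap := h.map_interarrival n
  have hpos : ∀ᵐ ω ∂μ, 0 < X n ω :=
    ae_of_ae_map (h.measurable_interarrival n).aemeasurable
      (by rw [hmap]; exact ae_pos_gammaMeasure 1 lam)
  refine integrable_and_integral_eq_of_lintegral_ofReal
    (h.measurable_interarrival n).ennreal_ofReal.aemeasurable (hpos.mono fun _ => le_of_lt)
    (one_div_nonneg.2 h.lam_pos.le) ?_
  rw [← lintegral_map (f := ENNReal.ofReal) (by fun_prop) (h.measurable_interarrival n), hmap,
    expMeasure, lintegral_id_gammaMeasure one_pos h.lam_pos]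

lemma ae_regularPath : ∀ᵐ ω ∂μ, RegularPath (X · ω) (S · ω) := by
  have hx : ∀ᵐ ω ∂μ, ∀ n, 0 < X n ω := ae_all_iff.2 fun n =>
    ae_of_ae_map (h.measurable_interarrival n).aemeasurable
      (by rw [h.map_interarrival n]; exact ae_pos_gammaMeasure 1 lam)
  have hs : ∀ᵐ ω ∂μ, ∀ n, 0 < S n ω := ae_all_iff.2 fun n =>
    ae_of_ae_map (h.measurable_service n).aemeasurable
      (by rw [h.map_service n]; exact ae_pos_gammaMeasure _ _)
  -- The strong law with positive mean `1 / lam` excludes accumulation of arrivals.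
  have hlln := strong_law_ae_real X (h.integral_interarrival 0).1
    (fun m n hmn => h.indep.indepFun (i := Sum.inl m) (j := Sum.inl n) (by simpa using hmn))
    (fun n => ⟨(h.measurable_interarrival n).aemeasurable,
      (h.measurable_interarrival 0).aemeasurable,
      by rw [h.map_interarrival, h.map_interarrival]⟩)
  rw [(h.integral_interarrival 0).2] at hlln
  filter_upwards [hx, hs, hlln] with ω hx hs hlln
  refine ⟨hx, hs, fun d => ?_⟩
  have htop : Tendsto (fun n : ℕ => (∑ j ∈ Finset.range n, X j ω) / n * n) atTop atTop :=
    hlln.pos_mul_atTop (one_div_pos.2 h.lam_pos) tendsto_natCast_atTop_atTop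
  obtain ⟨n, hn, hn0⟩ := ((htop.eventually_gt_atTop d).and (eventually_gt_atTop 0)).exists
  obtain ⟨n, rfl⟩ := Nat.exists_eq_succ_of_ne_zero hn0.ne'
  rw [div_mul_cancel₀ _ (by positivity)] at hn
  exact ⟨n, hn⟩

variable [IsProbabilityMeasure μ]

lemma setLIntegral_start_eq_mul {i m : ℕ} {A : Set Ω} {w : Ω → ℝ} (hst : IsStart X S i m A w)
    {H : ℝ × ℝ → ENNReal} (hH : Measurable H) :
    ∫⁻ ω in startEvent X m A w, H (S m ω, X (m + 1) ω - w ω) ∂μ =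
      (∫⁻ ω in A, ENNReal.ofReal (Real.exp (-(lam * w ω))) ∂μ) *
        ∫⁻ s, ∫⁻ x, H (s, x) ∂expMeasure lam ∂gammaMeasure (k : ℝ) θ⁻¹ := by
  have := isProbabilityMeasure_expMeasure h.lam_pos
  have hw : Measurable w := hst.measurable_wait.mono (h.pastSigma_le m) le_rfl
  have hK : Measurable fun s => ∫⁻ x, H (s, x) ∂expMeasure lam := hH.lintegral_prod_right'
  have hlt : MeasurableSet {ω | w ω < X (m + 1) ω} :=
    measurableSet_lt hw (h.measurable_interarrival _)
  -- The service time of `m` joins the past, so that the next interarrival time is integrated out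
  -- first, by memorylessness; the service time is integrated out afterwards.
  set T : Set (ℕ ⊕ ℕ) := insert (Sum.inr m) (pastIndices m) with hT
  have hle : pastSigma X S m ≤ familySigma (Sum.elim X S) T :=
    familySigma_mono _ (Set.subset_insert _ _)
  have hxT : (Sum.inl (m + 1) : ℕ ⊕ ℕ) ∉ T := by simp [hT, pastIndices]
  have hsT : (Sum.inr m : ℕ ⊕ ℕ) ∉ pastIndices m := by simp [pastIndices]
  have hS : Measurable[familySigma (Sum.elim X S) T] (S m) :=
    measurable_familySigma (Z := Sum.elim X S) (t := Sum.inr m) (Set.mem_insert _ _)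
  have hf : Measurable fun p : (ℝ × ℝ) × ℝ =>
      if p.1.1 < p.2 then H (p.1.2, p.2 - p.1.1) else 0 :=
    Measurable.ite (measurableSet_lt (by fun_prop) (by fun_prop)) (by fun_prop) measurable_const
  have hx := setLIntegral_integrate_out h.measurable_input h.indep hxT
    ((hst.measurable_wait.mono hle le_rfl).prodMk hS) (hle _ hst.measurableSet_event) hf
  have hf' : Measurable fun p : ℝ × ℝ => ENNReal.ofReal (Real.exp (-(lam * p.1))) *
      ∫⁻ x, H (p.2, x) ∂expMeasure lam :=
    Measurable.mul (by fun_prop) (hK.comp measurable_snd)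
  have hs := setLIntegral_integrate_out h.measurable_input h.indep hsT
    hst.measurable_wait hst.measurableSet_event hf'
  simp only [Sum.elim_inl, Sum.elim_inr, h.map_interarrival, h.map_service] at hx hs
  have hleft : ∫⁻ ω in startEvent X m A w, H (S m ω, X (m + 1) ω - w ω) ∂μ =
      ∫⁻ ω in A, (if w ω < X (m + 1) ω then H (S m ω, X (m + 1) ω - w ω) else 0) ∂μ := by
    rw [startEvent, Set.inter_comm, ← Measure.restrict_restrict hlt,
      ← lintegral_indicator hlt]
    refine lintegral_congr fun ω => ?_
    simp [Set.indicator]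
  refine hleft.trans (hx.trans ?_)
  rw [← lintegral_mul_const _ (by fun_prop)]
  refine (lintegral_congr fun ω => lintegral_expMeasure_shift (hst.wait_nonneg ω)
    (hH.comp measurable_prodMk_left)).trans (hs.trans ?_)
  exact lintegral_congr fun ω => lintegral_const_mul _ hK

/-- At the start of a service, the service time and the residual interarrival time are
independent of the past and distributed as fresh ones. -/
lemma setLIntegral_start {i m : ℕ} {A : Set Ω} {w : Ω → ℝ} (hst : IsStart X S i m A w)
    {H : ℝ × ℝ → ENNReal} (hH : Measurable H) :
    ∫⁻ ω in startEvent X m A w, H (S m ω, X (m + 1) ω - w ω) ∂μ =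
      μ (startEvent X m A w) *
        ∫⁻ s, ∫⁻ x, H (s, x) ∂expMeasure lam ∂gammaMeasure (k : ℝ) θ⁻¹ := by
  have := isProbabilityMeasure_expMeasure h.lam_pos
  have := isProbabilityMeasure_gammaMeasure (a := (k : ℝ)) (by exact_mod_cast h.k_pos)
    (inv_pos.2 h.theta_pos)
  -- Taking `H = 1` identifies the first factor as the probability of the start event.
  have h1 := h.setLIntegral_start_eq_mul hst (H := fun _ => 1) measurable_const
  simp only [lintegral_const, measure_univ, mul_one, one_mul, Measure.restrict_apply_univ] at h1
  rw [h1, h.setLIntegral_start_eq_mul hst hH]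

/-- Almost surely exactly one start event occurs, so their probabilities sum to one. A quantity with
the same conditional mean `c` on each of them therefore has mean `c`. -/
lemma lintegral_of_start {i : ℕ} {A : ℕ → Set Ω} {w : ℕ → Ω → ℝ}
    (hst : ∀ m, IsStart X S i m (A m) (w m)) {f : Ω → ENNReal} {g : ℕ → Ω → ENNReal}
    {c : ENNReal} (hg : ∀ m, Measurable (g m))
    (hfg : ∀ ω m, RegularPath (X · ω) (S · ω) → successIndex (X · ω) (S · ω) i = m →
      f ω = g m ω)
    (hint : ∀ m, ∫⁻ ω in startEvent X m (A m) (w m), g m ω ∂μ =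
      μ (startEvent X m (A m) (w m)) * c) :
    AEMeasurable f μ ∧ ∫⁻ ω, f ω ∂μ = c := by
  have hB : ∀ m, MeasurableSet (startEvent X m (A m) (w m)) := fun m =>
    h.pastSigma_le (m + 1) _ (hst m).measurableSet_startEvent
  have key : ∀ (f : Ω → ENNReal) (g : ℕ → Ω → ENNReal), (∀ ω m, RegularPath (X · ω) (S · ω) →
      successIndex (X · ω) (S · ω) i = m → f ω = g m ω) →
      f =ᵐ[μ] fun ω => ∑' m, (startEvent X m (A m) (w m)).indicator (g m) ω := by
    intro f g hfg
    filter_upwards [h.ae_regularPath] with ω hω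
    rw [tsum_eq_single (successIndex (X · ω) (S · ω) i), Set.indicator_of_mem
      (show ω ∈ startEvent X _ _ _ from ((hst _).successIndex_eq_iff ω hω).1 rfl)]
    · exact hfg ω _ hω rfl
    · intro m hm
      exact Set.indicator_of_notMem (s := startEvent X m (A m) (w m))
        (fun hmem => hm (((hst m).successIndex_eq_iff ω hω).2 hmem).symm) (g m)
  have hind : ∀ m, Measurable ((startEvent X m (A m) (w m)).indicator (g m)) := fun m =>
    (hg m).indicator (hB m)
  have hsum : ∑' m, μ (startEvent X m (A m) (w m)) = 1 := by
    have h1 := lintegral_congr_ae (key (fun _ => 1) (fun _ _ => 1) fun _ _ _ _ => rfl)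
    rw [lintegral_tsum fun m => (measurable_const.indicator (hB m)).aemeasurable] at h1
    simpa [lintegral_indicator (hB _)] using h1.symm
  refine ⟨(Measurable.tsum hind).aemeasurable.congr (key f g hfg).symm, ?_⟩
  rw [lintegral_congr_ae (key f g hfg), lintegral_tsum fun m => (hind m).aemeasurable]
  simp only [lintegral_indicator (hB _), hint]
  rw [ENNReal.tsum_mul_right, hsum, one_mul]

end IsQueueInput

end LCFS

/-! ### Means of the service, idle and waiting times -/

namespace LCFS

namespace IsQueueInput

variable {Ω : Type*} [mΩ : MeasurableSpace Ω] {μ : Measure Ω} [IsProbabilityMeasure μ]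
  {lam θ : ℝ} {k : ℕ} {X S : ℕ → Ω → ℝ} (h : IsQueueInput μ lam θ k X S)
include h

lemma setLIntegral_integrate_out_interarrival {T : Set (ℕ ⊕ ℕ)} {B : Set Ω} {u : Ω → ℝ}
    (hB : MeasurableSet[familySigma (Sum.elim X S) T] B)
    (hu : Measurable[familySigma (Sum.elim X S) T] u) {p : ℕ}
    (hT : ∀ l, Sum.inl (p + l) ∉ T) (j : ℕ) {f : ℝ × ℝ → ENNReal} (hf : Measurable f) :
    ∫⁻ ω in B, f (u ω - ∑ l ∈ Finset.range j, X (p + l) ω, X (p + j) ω) ∂μ =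
      ∫⁻ ω in B, ∫⁻ z, f (u ω - ∑ l ∈ Finset.range j, X (p + l) ω, z) ∂expMeasure lam ∂μ := by
  set T' : Set (ℕ ⊕ ℕ) := T ∪ {t | ∃ l < j, t = Sum.inl (p + l)} with hT'
  have hle : familySigma (Sum.elim X S) T ≤ familySigma (Sum.elim X S) T' :=
    familySigma_mono _ Set.subset_union_left
  have hnot : (Sum.inl (p + j) : ℕ ⊕ ℕ) ∉ T' := by
    rintro (hmem | ⟨l, hl, heq⟩)
    · exact hT j hmem
    · have := Sum.inl_injective heq
      omega
  have hmeas : Measurable[familySigma (Sum.elim X S) T']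
      (fun ω => u ω - ∑ l ∈ Finset.range j, X (p + l) ω) :=
    (hu.mono hle le_rfl).sub (Finset.measurable_fun_sum _ fun l hl =>
      measurable_familySigma (Z := Sum.elim X S) (t := Sum.inl (p + l))
        (Or.inr ⟨l, Finset.mem_range.1 hl, rfl⟩))
  have := setLIntegral_integrate_out h.measurable_input h.indep hnot hmeas (hle _ hB) hf
  simpa only [Sum.elim_inl, h.map_interarrival] using this

/-- Integrating out the latest interarrival time raises the number of arrivals by one; hence the
induction on `j` with `n` free. -/
lemma setLIntegral_lastArrivalAge {T : Set (ℕ ⊕ ℕ)} {B : Set Ω} {u : Ω → ℝ}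
    (hB : MeasurableSet[familySigma (Sum.elim X S) T] B)
    (hu : Measurable[familySigma (Sum.elim X S) T] u) {p : ℕ}
    (hT : ∀ l, Sum.inl (p + l) ∉ T) (n j : ℕ) :
    ∫⁻ ω in B, lastArrivalAge lam n (u ω - ∑ l ∈ Finset.range j, X (p + l) ω) ∂μ =
      ∫⁻ ω in B, lastArrivalAge lam (n + j) (u ω) ∂μ := by
  induction j generalizing n with
  | zero => simp
  | succ j ih =>
    have := h.setLIntegral_integrate_out_interarrival hB hu hT j
      (f := fun q => lastArrivalAge lam n (q.1 - q.2)) (by fun_prop)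
    simp only [lintegral_lastArrivalAge h.lam_pos] at this
    simp only [Finset.sum_range_succ, ← sub_sub]
    rw [this, ih, add_right_comm, add_assoc]

lemma setLIntegral_ageBeforeNext {T : Set (ℕ ⊕ ℕ)} {B : Set Ω} {u : Ω → ℝ}
    (hB : MeasurableSet[familySigma (Sum.elim X S) T] B)
    (hu : Measurable[familySigma (Sum.elim X S) T] u) {p : ℕ}
    (hT : ∀ l, Sum.inl (p + l) ∉ T) (j : ℕ) :
    ∫⁻ ω in B, ageBeforeNext (u ω - ∑ l ∈ Finset.range j, X (p + l) ω, X (p + j) ω) ∂μ =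
      ∫⁻ ω in B, lastArrivalAge lam j (u ω) ∂μ := by
  rw [h.setLIntegral_integrate_out_interarrival hB hu hT j measurable_ageBeforeNext]
  simp only [lintegral_ageBeforeNext h.lam_pos]
  rw [h.setLIntegral_lastArrivalAge hB hu hT, zero_add]

lemma lintegral_service (i : ℕ) :
    AEMeasurable (fun ω => ENNReal.ofReal (S (successIndex (X · ω) (S · ω) i) ω)) μ ∧
      ∫⁻ ω, ENNReal.ofReal (S (successIndex (X · ω) (S · ω) i) ω) ∂μ =
        ENNReal.ofReal (k * θ) := by
  obtain ⟨A, w, hst⟩ := exists_isStart X S i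
  refine h.lintegral_of_start hst (g := fun m ω => ENNReal.ofReal (S m ω))
    (fun m => (h.measurable_service m).ennreal_ofReal) ?_ fun m => ?_
  · rintro ω m - rfl
    rfl
  · have := isProbabilityMeasure_expMeasure h.lam_pos
    have hH := h.setLIntegral_start (hst m) (H := fun q => ENNReal.ofReal q.1) (by fun_prop)
    simp only [lintegral_const, measure_univ, mul_one] at hH
    rw [hH, lintegral_id_gammaMeasure (by exact_mod_cast h.k_pos) (inv_pos.2 h.theta_pos),
      div_inv_eq_mul]

lemma lintegral_idle (i : ℕ) :
    AEMeasurable (fun ω => ENNReal.ofReal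
        (max (arrivalTime (X · ω) (successIndex (X · ω) (S · ω) (i + 1)) -
          deliveryTime (X · ω) (S · ω) i) 0)) μ ∧
      ∫⁻ ω, ENNReal.ofReal
        (max (arrivalTime (X · ω) (successIndex (X · ω) (S · ω) (i + 1)) -
          deliveryTime (X · ω) (S · ω) i) 0) ∂μ =
        ENNReal.ofReal (1 / lam / (1 + lam * θ) ^ k) := by
  have hlam := h.lam_pos
  have hθ := h.theta_pos
  have hk : (0 : ℝ) < k := by exact_mod_cast h.k_pos
  obtain ⟨A, w, hst⟩ := exists_isStart X S i
  have hmeas : ∀ m, Measurable (w m) := fun m =>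
    (hst m).measurable_wait.mono (h.pastSigma_le m) le_rfl
  refine h.lintegral_of_start hst
    (g := fun m ω => ENNReal.ofReal (X (m + 1) ω - w m ω - S m ω))
    (fun m => (((h.measurable_interarrival _).sub (hmeas m)).sub
      (h.measurable_service m)).ennreal_ofReal) ?_ fun m => ?_
  · intro ω m hω hm
    have hd := (hst m).deliveryTime_eq ω hω hm
    obtain ⟨h₁, -, h₃⟩ := hω.successIndex_succ_spec i
    rw [hm] at h₁ h₃
    have ha := arrivalTime_succ (X · ω) m
    rw [show X (m + 1) ω - w m ω - S m ω =
      arrivalTime (X · ω) (m + 1) - deliveryTime (X · ω) (S · ω) i by rw [hd, ha]; ring]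
    -- If the next packet was already waiting, packet `m + 1` had arrived by the delivery, and both
    -- sides vanish; otherwise the next packet is `m + 1`.
    rcases h₃ with h₃ | h₃
    · have hle := hω.arrivalTime_strictMono.monotone (Nat.succ_le_of_lt h₁)
      rw [max_eq_right (by linarith), ENNReal.ofReal_zero,
        ENNReal.ofReal_of_nonpos (by rw [Nat.succ_eq_add_one] at hle; linarith)]
    · rw [h₃, ENNReal.ofReal_max, ENNReal.ofReal_zero, max_eq_left zero_le]
  · rw [h.setLIntegral_start (hst m) (H := fun q => ENNReal.ofReal (q.2 - q.1)) (by fun_prop)]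
    congr 1
    obtain ⟨hi, he⟩ := integral_exp_gammaMeasure hk (inv_pos.2 hθ) hlam.le
    have hcongr : ∫⁻ s, ∫⁻ x, ENNReal.ofReal (x - s) ∂expMeasure lam
        ∂gammaMeasure (k : ℝ) θ⁻¹ =
        ∫⁻ s, ENNReal.ofReal (Real.exp (-(lam * s)) / lam) ∂gammaMeasure (k : ℝ) θ⁻¹ := by
      refine lintegral_congr_ae ?_
      filter_upwards [ae_pos_gammaMeasure (k : ℝ) θ⁻¹] with s hs
      exact lintegral_expMeasure_excess hlam hs.le
    rw [hcongr, ← ofReal_integral_eq_lintegral_ofReal (hi.div_const lam)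
      (ae_of_all _ fun s => by positivity), integral_div, he, Real.rpow_natCast]
    congr 1
    rw [show θ⁻¹ / (θ⁻¹ + lam) = 1 / (1 + lam * θ) by field_simp, div_pow, one_pow]
    ring

/-- The wait is decomposed over the candidates `m + 1 + j` for the last arrival before the delivery.
The `j`-th term is the mean age with exactly `j + 1` arrivals during the service. -/
lemma lintegral_waiting (i : ℕ) :
    ∃ c : ℝ, 0 ≤ c ∧ c = 1 / lam - 1 / lam / (1 + lam * θ) ^ k - k * θ / (1 + lam * θ) ^ (k + 1) ∧
    AEMeasurable (fun ω => ENNReal.ofReal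
        (max (deliveryTime (X · ω) (S · ω) i -
          arrivalTime (X · ω) (successIndex (X · ω) (S · ω) (i + 1))) 0)) μ ∧
      ∫⁻ ω, ENNReal.ofReal
        (max (deliveryTime (X · ω) (S · ω) i -
          arrivalTime (X · ω) (successIndex (X · ω) (S · ω) (i + 1))) 0) ∂μ =
        ENNReal.ofReal c := by
  have hlam := h.lam_pos
  obtain ⟨c, hc0, hc, hlint⟩ := lintegral_tsum_lastArrivalAge hlam h.theta_pos h.k_pos
  refine ⟨c, hc0, hc, ?_⟩
  obtain ⟨A, w, hst⟩ := exists_isStart X S i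
  have hmeas : ∀ m, Measurable (w m) := fun m =>
    (hst m).measurable_wait.mono (h.pastSigma_le m) le_rfl
  have hg : ∀ m j, Measurable fun ω => ageBeforeNext (w m ω + S m ω - X (m + 1) ω -
      ∑ l ∈ Finset.range j, X (m + 1 + 1 + l) ω, X (m + 1 + 1 + j) ω) := fun m j =>
    measurable_ageBeforeNext.comp ((((hmeas m).add (h.measurable_service m)).sub
      (h.measurable_interarrival _)).sub (Finset.measurable_fun_sum _ fun l _ =>
        h.measurable_interarrival _) |>.prodMk (h.measurable_interarrival _))
  refine h.lintegral_of_start hst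
    (g := fun m ω => ∑' j, ageBeforeNext (w m ω + S m ω - X (m + 1) ω -
      ∑ l ∈ Finset.range j, X (m + 1 + 1 + l) ω, X (m + 1 + 1 + j) ω))
    (fun m => Measurable.tsum (hg m)) ?_ fun m => ?_
  · intro ω m hω hm
    have hd := (hst m).deliveryTime_eq ω hω hm
    have hr : ∀ j, w m ω + S m ω - X (m + 1) ω -
        ∑ l ∈ Finset.range j, X (m + 1 + 1 + l) ω =
        deliveryTime (X · ω) (S · ω) i - arrivalTime (X · ω) (m + 1 + j) := by
      intro j
      rw [arrivalTime_add, arrivalTime_succ, hd]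
      ring
    have hsucc : ∀ j, arrivalTime (X · ω) (m + 1 + j + 1) =
        arrivalTime (X · ω) (m + 1 + j) + X (m + 1 + 1 + j) ω := by
      intro j
      rw [arrivalTime_succ, show m + 1 + 1 + j = m + 1 + j + 1 by ring]
    obtain ⟨h₁, h₂, -⟩ := hω.successIndex_succ_spec i
    rw [hm] at h₁
    obtain ⟨j, hj⟩ := Nat.exists_eq_add_of_le (Nat.succ_le_of_lt h₁)
    rw [Nat.succ_eq_add_one] at hj
    simp only [hr]
    rw [tsum_eq_single j]
    · rw [hj, hsucc] at h₂
      rw [hj, ageBeforeNext]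
      split_ifs with hif
      · rw [max_eq_left hif.1]
      · have : ¬ 0 ≤ deliveryTime (X · ω) (S · ω) i - arrivalTime (X · ω) (m + 1 + j) :=
          fun hcon => hif ⟨hcon, by linarith⟩
        rw [max_eq_right (by linarith), ENNReal.ofReal_zero]
    · intro l hl
      refine if_neg fun hif => hl ?_
      have := (hω.nextPacket_eq_iff (m := successIndex (X · ω) (S · ω) i) (n := m + 1 + l)
        (d := deliveryTime (X · ω) (S · ω) i)).2
        ⟨by omega, by rw [hsucc]; linarith [hif.2], Or.inl (by linarith [hif.1])⟩
      rw [← successIndex_succ, hj] at this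
      omega
  · rw [lintegral_tsum fun j => (hg m j).aemeasurable]
    have hstep : ∀ j, ∫⁻ ω in startEvent X m (A m) (w m),
        ageBeforeNext (w m ω + S m ω - X (m + 1) ω - ∑ l ∈ Finset.range j, X (m + 1 + 1 + l) ω,
          X (m + 1 + 1 + j) ω) ∂μ =
        μ (startEvent X m (A m) (w m)) *
          ∫⁻ s, lastArrivalAge lam (j + 1) s ∂gammaMeasure (k : ℝ) θ⁻¹ := by
      intro j
      have hu : Measurable[pastSigma X S (m + 1)] fun ω => w m ω + S m ω - X (m + 1) ω :=
        (((hst m).measurable_wait.mono (pastSigma_mono X S (Nat.le_succ m)) le_rfl).add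
          (measurable_service_pastSigma (Nat.lt_succ_self m))).sub
          (measurable_interarrival_pastSigma le_rfl)
      rw [h.setLIntegral_ageBeforeNext (hst m).measurableSet_startEvent hu
        (p := m + 1 + 1) (fun l => by simp [pastIndices]; omega) j]
      -- The arrival of `m + 1`, a residual interarrival time after the start, accounts for the
      -- shift from `j` to `j + 1`.
      have := h.setLIntegral_start (hst m)
        (H := fun q => lastArrivalAge lam j (q.1 - q.2)) (by fun_prop)
      simp only [lintegral_lastArrivalAge hlam] at this
      rw [← this]
      refine lintegral_congr fun ω => ?_
      congr 1
      ring
    simp only [hstep]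
    rw [ENNReal.tsum_mul_left, ← lintegral_tsum fun j => by fun_prop, ← hlint]
    congr 1
    refine lintegral_congr_ae ?_
    filter_upwards [ae_pos_gammaMeasure (k : ℝ) θ⁻¹] with s hs
    exact tsum_lastArrivalAge hlam hs.le

lemma integral_service (i : ℕ) :
    Integrable (fun ω => S (successIndex (X · ω) (S · ω) i) ω) μ ∧
      ∫ ω, S (successIndex (X · ω) (S · ω) i) ω ∂μ = k * θ := by
  obtain ⟨hm, hl⟩ := h.lintegral_service i
  have := h.theta_pos
  have hnn : ∀ᵐ ω ∂μ, 0 ≤ S (successIndex (X · ω) (S · ω) i) ω := by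
    filter_upwards [h.ae_regularPath] with ω hω using (hω.service_pos _).le
  exact integrable_and_integral_eq_of_lintegral_ofReal hm hnn (by positivity) hl

lemma integral_systemTime_succ (i : ℕ) :
    Integrable (fun ω => systemTime (X · ω) (S · ω) (i + 1)) μ ∧
      ∫ ω, systemTime (X · ω) (S · ω) (i + 1) ∂μ =
        1 / lam - 1 / lam / (1 + lam * θ) ^ k - k * θ / (1 + lam * θ) ^ (k + 1) + k * θ := by
  obtain ⟨c, hc0, hc, hm, hl⟩ := h.lintegral_waiting i
  obtain ⟨hi, he⟩ := integrable_and_integral_eq_of_lintegral_ofReal hm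
    (ae_of_all _ fun ω => le_max_right _ _) hc0 hl
  obtain ⟨hi', he'⟩ := h.integral_service (i + 1)
  simp only [systemTime_succ]
  exact ⟨hi.add hi', by rw [integral_add hi hi', he, he', hc]⟩

lemma integral_interdepartureTime (i : ℕ) :
    Integrable (fun ω => interdepartureTime (X · ω) (S · ω) i) μ ∧
      ∫ ω, interdepartureTime (X · ω) (S · ω) i ∂μ =
        1 / lam / (1 + lam * θ) ^ k + k * θ := by
  have hlam := h.lam_pos
  have hθ := h.theta_pos
  obtain ⟨hm, hl⟩ := h.lintegral_idle i
  obtain ⟨hi, he⟩ := integrable_and_integral_eq_of_lintegral_ofReal hm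
    (ae_of_all _ fun ω => le_max_right _ _) (by positivity) hl
  obtain ⟨hi', he'⟩ := h.integral_service (i + 1)
  simp only [interdepartureTime_eq]
  exact ⟨hi.add hi', by rw [integral_add hi hi', he, he']⟩

end IsQueueInput

/-! ### Passage to measurable versions and conclusion -/

/-- Random variables with the required laws agree almost surely with measurable queue inputs. -/
lemma exists_isQueueInput {Ω : Type*} [MeasurableSpace Ω] {μ : Measure Ω}
    {lam θ : ℝ} (hlam : 0 < lam) (hθ : 0 < θ) {k : ℕ} (hk : 1 ≤ k) {X S : ℕ → Ω → ℝ}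
    (hX : ∀ n, HasLaw (X n) (expMeasure lam) μ)
    (hS : ∀ n, HasLaw (S n) (gammaMeasure (k : ℝ) θ⁻¹) μ)
    (hindep : iIndepFun (Sum.elim X S) μ) :
    ∃ X' S' : ℕ → Ω → ℝ, IsQueueInput μ lam θ k X' S' ∧
      ∀ᵐ ω ∂μ, (X · ω) = (X' · ω) ∧ (S · ω) = (S' · ω) := by
  have hXm := fun n => (hX n).aemeasurable
  have hSm := fun n => (hS n).aemeasurable
  refine ⟨fun n => (hXm n).mk, fun n => (hSm n).mk, ⟨hlam, hθ, hk, ?_, fun n => ?_, fun n => ?_,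
    ?_⟩, ?_⟩
  · rintro (n | n)
    · exact (hXm n).measurable_mk
    · exact (hSm n).measurable_mk
  · rw [← (hX n).map_eq]
    exact Measure.map_congr (hXm n).ae_eq_mk.symm
  · rw [← (hS n).map_eq]
    exact Measure.map_congr (hSm n).ae_eq_mk.symm
  · refine hindep.congr ?_
    rintro (n | n)
    · exact (hXm n).ae_eq_mk
    · exact (hSm n).ae_eq_mk
  · filter_upwards [ae_all_iff.2 fun n => (hXm n).ae_eq_mk,
      ae_all_iff.2 fun n => (hSm n).ae_eq_mk] with ω h₁ h₂
    exact ⟨funext h₁, funext h₂⟩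

end LCFS

theorem mainTheorem4 {Ω : Type*} [MeasurableSpace Ω] (μ : Measure Ω) [IsProbabilityMeasure μ]
    (lam θ : ℝ) (hlam : 0 < lam) (hθ : 0 < θ) (k : ℕ) (hk : 1 ≤ k) (Δ₀ : ℝ)
    (X S : ℕ → Ω → ℝ)
    (hX : ∀ n, HasLaw (X n) (expMeasure lam) μ)
    (hS : ∀ n, HasLaw (S n) (gammaMeasure (k : ℝ) θ⁻¹) μ)
    (hindep : iIndepFun (Sum.elim X S) μ)
    (i : ℕ) (hi : 1 ≤ i) :
    (∀ᵐ ω ∂μ, Tendsto (LCFS.age Δ₀ (X · ω) (S · ω))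
        (𝓝[<] LCFS.deliveryTime (X · ω) (S · ω) (i + 1))
        (𝓝 (LCFS.peakAge Δ₀ (X · ω) (S · ω) (i + 1)))) ∧
    Integrable (fun ω => LCFS.peakAge Δ₀ (X · ω) (S · ω) (i + 1)) μ ∧
    Integrable (fun ω => LCFS.systemTime (X · ω) (S · ω) i) μ ∧
    Integrable (fun ω => LCFS.interdepartureTime (X · ω) (S · ω) i) μ ∧
    (∫ ω, LCFS.peakAge Δ₀ (X · ω) (S · ω) (i + 1) ∂μ =
      (∫ ω, LCFS.systemTime (X · ω) (S · ω) i ∂μ) +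
        ∫ ω, LCFS.interdepartureTime (X · ω) (S · ω) i ∂μ) ∧
    ∫ ω, LCFS.peakAge Δ₀ (X · ω) (S · ω) (i + 1) ∂μ =
      1 / lam + 2 * k * θ - k * θ / (1 + lam * θ) ^ (k + 1) := by
  obtain ⟨X', S', h, hae⟩ := LCFS.exists_isQueueInput hlam hθ hk hX hS hindep
  -- Packet `0` never waits, so the mean system time formula holds only from the second success on.
  obtain ⟨i, rfl⟩ := Nat.exists_eq_add_of_le' hi
  obtain ⟨hT, heT⟩ := h.integral_systemTime_succ i
  obtain ⟨hY, heY⟩ := h.integral_interdepartureTime (i + 1)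
  have hTae : (fun ω => LCFS.systemTime (X · ω) (S · ω) (i + 1)) =ᵐ[μ]
      fun ω => LCFS.systemTime (X' · ω) (S' · ω) (i + 1) := by
    filter_upwards [hae] with ω hω
    rw [hω.1, hω.2]
  have hYae : (fun ω => LCFS.interdepartureTime (X · ω) (S · ω) (i + 1)) =ᵐ[μ]
      fun ω => LCFS.interdepartureTime (X' · ω) (S' · ω) (i + 1) := by
    filter_upwards [hae] with ω hω
    rw [hω.1, hω.2]
  have hreg : ∀ᵐ ω ∂μ, LCFS.RegularPath (X · ω) (S · ω) := by
    filter_upwards [hae, h.ae_regularPath] with ω hω hr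
    rwa [hω.1, hω.2]
  have hPae : (fun ω => LCFS.peakAge Δ₀ (X · ω) (S · ω) (i + 1 + 1)) =ᵐ[μ]
      fun ω => LCFS.systemTime (X · ω) (S · ω) (i + 1) +
        LCFS.interdepartureTime (X · ω) (S · ω) (i + 1) := by
    filter_upwards [hreg] with ω hω using hω.peakAge_succ Δ₀ (i + 1)
  have hT' := hT.congr hTae.symm
  have hY' := hY.congr hYae.symm
  have hsum := (integral_congr_ae hPae).trans (integral_add hT' hY')
  refine ⟨?_, (hT'.add hY').congr hPae.symm, hT', hY', hsum, ?_⟩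
  · filter_upwards [hreg] with ω hω
    rw [hω.peakAge_succ]
    exact hω.tendsto_age Δ₀ (i + 1)
  · rw [hsum, integral_congr_ae hTae, integral_congr_ae hYae, heT, heY]
    ring
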